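/- Let $\alpha_1,\alpha_2,\alpha_3\in\mathbb C$ be distinct, let $p(z)=(z-\alpha_1)(z-\alpha_2)(z-\alpha_3)=z^3+az^2+bz+c$, and let $$P(z_1,z_2,z_3)=z_1z_2z_3+\tfrac a3(z_1z_2+z_2z_3+z_3z_1)+\tfrac b3(z_1+z_2+z_3)+c$$ be its polarization. Put $e_1=e^{-i\pi/3}$, $e_2=e^{i\pi/3}$, $e_3=-1$, and let $W$ be the Möbius transformation of $\mathbb C^*=\mathbb C\cup\{\infty\}$ with $W(e_k)=\alpha_k$, that is $$W(z)=-\frac{z(\alpha_1\alpha_2e_3+\alpha_1\alpha_3e_2+\alpha_2\alpha_3e_1)+(\alpha_1\alpha_2e_3+\alpha_1\alpha_3e_1+\alpha_2\alpha_3e_2)}{z(\alpha_1e_1+\alpha_2e_2+\alpha_3e_3)+(\alpha_1e_2+\alpha_2e_1+\alpha_3e_3)}.$$ Let $u^*=W(\infty)$ and $v^*=W(0)$. Let $(z_1,z_2,z_3)\in\mathbb C^3$ be a solution of $P(z_1,z_2,z_3)=0$ with $z_1,z_2,z_3$ pairwise distinct that is non-degenerate, i.e. $z_k\notin\{u^*,v^*\}$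 for $k=1,2,3$. Put $u_k=W^{-1}(z_k)\in\mathbb C\setminus\{0\}$ and let $w_k=\sqrt{u_k}$ be the principal square root. For $\{k,\ell,j\}=\{1,2,3\}$ let $$f_{k,1}=W(w_\ell w_j),\qquad f_{k,2}=W(-w_\ell w_j).$$ Then $f_{k,1}\neq f_{k,2}$ are exactly the zeros in $\mathbb C^*$ of $z\mapsto P(z,z,z_k)$ (where $\infty$ counts as a zero when the coefficient of $z^2$ vanishes). In each of the following seven triples the points determine a unique circle of $\mathbb C^*$ (a circle, or a straight line together with $\infty$): - $C_1$: $f_{1,1},z_2,z_3$; - $C_2$: $z_1,f_{2,1},z_3$; - $C_3$: $z_1,z_2,f_{3,1}$; - $C_4$: $f_{1,2},f_{2,2},f_{3,2}$; - $C_5$: $f_{1,1},f_{2,1},f_{3,2}$; - $C_6$: $f_{1,1},f_{2,2},f_{3,1}$; - $C_7$: $f_{1,2},f_{2,1},f_{3,1}$. There is a (possibly degenerate) real conic $N\subset\mathbb C$ through the six points $W^{-1}(f_{k,i})$, $k=1,2,3$, $i=1,2$, and it is unique unless these six points are collinear. The seven circles have a common point $x\in\mathbb C^*$ which also lies on the curve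 $W(N)$ for every conic $N$ through the six points. Moreover, this holds with $x=W(u_0)$, where $$u_0=\frac{\det A}{\det B},\quad A=\begin{pmatrix}\bar w_1\bar w_2&\bar w_1\bar w_3&\bar w_2\bar w_3\\ w_3&w_2&w_1\\ \bar w_3&\bar w_2&\bar w_1\end{pmatrix},\quad B=\begin{pmatrix}\bar u_1&\bar u_2&\bar u_3\\ \bar w_1/w_1&\bar w_2/w_2&\bar w_3/w_3\\ 1&1&1\end{pmatrix},$$ whenever $\det B\neq0$. -/

import Mathlib

open OnePoint ComplexConjugate

noncomputable section

namespace PolarizedCubic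

/-! Throughout, `α 0, α 1, α 2` are the zeros of the monic cubic
`p(z) = z ^ 3 + a z ^ 2 + b z + c`, and the extended complex plane is `OnePoint ℂ`. -/

/-- The coefficient `a` of `p(z) = (z - α₁)(z - α₂)(z - α₃)`. -/
def coeffA (α : Fin 3 → ℂ) : ℂ := -(α 0 + α 1 + α 2)

/-- The coefficient `b` of `p`. -/
def coeffB (α : Fin 3 → ℂ) : ℂ := α 0 * α 1 + α 1 * α 2 + α 2 * α 0

/-- The coefficient `c` of `p`. -/
def coeffC (α : Fin 3 → ℂ) : ℂ := -(α 0 * α 1 * α 2)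

/-- The polarization `P(z₁, z₂, z₃)` of `p`. -/
def P (α : Fin 3 → ℂ) (z₁ z₂ z₃ : ℂ) : ℂ :=
  z₁ * z₂ * z₃ + coeffA α / 3 * (z₁ * z₂ + z₂ * z₃ + z₃ * z₁)
    + coeffB α / 3 * (z₁ + z₂ + z₃) + coeffC α

/-- The cube roots of `-1`. -/
def e₁ : ℂ := Complex.exp (-(Complex.I * Real.pi / 3))

/-- The cube roots of `-1`. -/
def e₂ : ℂ := Complex.exp (Complex.I * Real.pi / 3)

/-- The cube roots of `-1`. -/
def e₃ : ℂ := -1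

/-- The quotient `n / d` in the extended plane, equal to `∞` if `d = 0`
(it is only used where `n` and `d` do not both vanish). -/
def quot (n d : ℂ) : OnePoint ℂ := open Classical in if d = 0 then ∞ else ((n / d : ℂ) : OnePoint ℂ)

/-- The map `z ↦ (p z + q) / (r z + s)` of the extended plane. -/
def moebius (p q r s : ℂ) (z : OnePoint ℂ) : OnePoint ℂ :=
  z.elim (quot p r) (fun z => quot (p * z + q) (r * z + s))

/-- `α₁α₂e₃ + α₁α₃e₂ + α₂α₃e₁` -/
def coeffN (α : Fin 3 → ℂ) : ℂ := α 0 * α 1 * e₃ + α 0 * α 2 * e₂ + α 1 * α 2 * e₁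

/-- `α₁α₂e₃ + α₁α₃e₁ + α₂α₃e₂` -/
def coeffM (α : Fin 3 → ℂ) : ℂ := α 0 * α 1 * e₃ + α 0 * α 2 * e₁ + α 1 * α 2 * e₂

/-- `α₁e₁ + α₂e₂ + α₃e₃` -/
def coeffR (α : Fin 3 → ℂ) : ℂ := α 0 * e₁ + α 1 * e₂ + α 2 * e₃

/-- `α₁e₂ + α₂e₁ + α₃e₃` -/
def coeffS (α : Fin 3 → ℂ) : ℂ := α 0 * e₂ + α 1 * e₁ + α 2 * e₃

/-- The point `u*`. -/
def uStar (α : Fin 3 → ℂ) : OnePoint ℂ := quot (-coeffN α) (coeffR α)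

/-- The point `v*`. -/
def vStar (α : Fin 3 → ℂ) : OnePoint ℂ := quot (-coeffM α) (coeffS α)

/-- The Möbius transformation `W`, which sends `e_k` to `α_k`. -/
def W (α : Fin 3 → ℂ) : OnePoint ℂ → OnePoint ℂ :=
  moebius (-coeffN α) (-coeffM α) (coeffR α) (coeffS α)

/-- The inverse transformation of `W`. -/
def Winv (α : Fin 3 → ℂ) : OnePoint ℂ → OnePoint ℂ :=
  moebius (-coeffS α) (-coeffM α) (coeffR α) (coeffN α)

/-- A non-degenerate solution of `P = 0`: no component equals `u*` or `v*`. -/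
def IsNondegenerateSolution (α z : Fin 3 → ℂ) : Prop :=
  P α (z 0) (z 1) (z 2) = 0 ∧
    ∀ k, (z k : OnePoint ℂ) ≠ uStar α ∧ (z k : OnePoint ℂ) ≠ vStar α

/-- The zeros in the extended plane of the quadratic
`ζ ↦ P(ζ, ζ, t) = (t + a / 3) ζ ^ 2 + …`; the point `∞` is a zero when the leading coefficient
vanishes. -/
def biZeros (α : Fin 3 → ℂ) (t : ℂ) : Set (OnePoint ℂ) :=
  {x | x.elim (t + coeffA α / 3 = 0) (fun ζ => P α ζ ζ t = 0)}

/-- `u_k = W⁻¹(z_k)` as a complex number (for a non-degenerate solution it is finite). -/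
def u (α z : Fin 3 → ℂ) (k : Fin 3) : ℂ := (Winv α (z k)).elim 0 id

/-- `w_k = √u_k`, the principal square root. -/
def w (α z : Fin 3 → ℂ) (k : Fin 3) : ℂ := Complex.sqrt (u α z k)

/-- `u_{k,1} = √u_ℓ √u_j` and `u_{k,2} = -√u_ℓ √u_j`, where `{ℓ, j, k}` is the full index set. -/
def uu (α z : Fin 3 → ℂ) (k : Fin 3) : Fin 2 → ℂ :=
  ![w α z (k + 1) * w α z (k + 2), -(w α z (k + 1) * w α z (k + 2))]

/-- The ordered zeros `f_{k,i} = W(u_{k,i})`. -/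
def f (α z : Fin 3 → ℂ) (k : Fin 3) (i : Fin 2) : OnePoint ℂ := W α (uu α z k i)

/-- Circles of the extended plane: the loci `A |x|² + 2 Re (B̄ x) + D = 0` with `A, D` real and
`|B|² > A D`. For `A ≠ 0` these are the circles of positive radius, and for `A = 0` the straight
lines together with `∞`. -/
def IsCircle (C : Set (OnePoint ℂ)) : Prop :=
  ∃ (A D : ℝ) (B : ℂ), A * D < Complex.normSq B ∧
    C = {x | x.elim (A = 0)
      (fun ζ => A * Complex.normSq ζ + 2 * (conj B * ζ).re + D = 0)}

/-- `C` is the circle determined by the three points `T 0, T 1, T 2`: the unique circle of the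
extended plane that passes through them. -/
def IsCircleDeterminedBy (C : Set (OnePoint ℂ)) (T : Fin 3 → OnePoint ℂ) : Prop :=
  (IsCircle C ∧ ∀ i, T i ∈ C) ∧ ∀ C', (IsCircle C' ∧ ∀ i, T i ∈ C') → C' = C

/-- The triples of points that determine the seven circles. -/
def circlePoints (α z : Fin 3 → ℂ) : Fin 7 → Fin 3 → OnePoint ℂ :=
  ![![f α z 0 0, z 1, z 2],
    ![z 0, f α z 1 0, z 2],
    ![z 0, z 1, f α z 2 0],
    ![f α z 0 1, f α z 1 1, f α z 2 1],
    ![f α z 0 0, f α z 1 0, f α z 2 1],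
    ![f α z 0 0, f α z 1 1, f α z 2 0],
    ![f α z 0 1, f α z 1 0, f α z 2 0]]

/-- Conics in the complex plane: zero sets of real polynomials of degree exactly two
(possibly degenerate). -/
def IsConic (N : Set ℂ) : Prop :=
  ∃ A B C D E F : ℝ, ¬(A = 0 ∧ B = 0 ∧ C = 0) ∧
    N = {ζ | A * ζ.re ^ 2 + B * (ζ.re * ζ.im) + C * ζ.im ^ 2 + D * ζ.re + E * ζ.im + F = 0}

/-- The six points `W⁻¹(f_{k,i})`. -/
def conicPoints (α z : Fin 3 → ℂ) : Set ℂ :=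
  {ζ | ∃ k i, (ζ : OnePoint ℂ) = Winv α (f α z k i)}

/-- `N` is a conic through the six points `W⁻¹(f_{k,i})`. -/
def IsConicThrough (N : Set ℂ) (α z : Fin 3 → ℂ) : Prop :=
  IsConic N ∧ ∀ k i, ∃ ζ ∈ N, (ζ : OnePoint ℂ) = Winv α (f α z k i)

/-- The matrix `A` in `u₀ = det A / det B`. -/
def matA (α z : Fin 3 → ℂ) : Matrix (Fin 3) (Fin 3) ℂ :=
  !![conj (w α z 0) * conj (w α z 1), conj (w α z 0) * conj (w α z 2),
      conj (w α z 1) * conj (w α z 2);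
    w α z 2, w α z 1, w α z 0;
    conj (w α z 2), conj (w α z 1), conj (w α z 0)]

/-- The matrix `B` in `u₀ = det A / det B`. -/
def matB (α z : Fin 3 → ℂ) : Matrix (Fin 3) (Fin 3) ℂ :=
  !![conj (u α z 0), conj (u α z 1), conj (u α z 2);
    conj (w α z 0) / w α z 0, conj (w α z 1) / w α z 1, conj (w α z 2) / w α z 2;
    1, 1, 1]

/-- The point `u₀ = det A / det B` (used only when `det B ≠ 0`). -/
def u₀ (α z : Fin 3 → ℂ) : ℂ := (matA α z).det / (matB α z).det

end PolarizedCubic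

end

/-!
In the coordinate `u = W⁻¹(z)` the polarized equation `P(z₁, z₂, z₃) = 0` becomes
`u₁ u₂ u₃ = -1` (`homP_W`), so that the zeros of `P(ζ, ζ, z_k)` are the images of the square roots
of `-1 / u_k = u_ℓ u_j`. Möbius transformations preserve circles
(`IsCircle.preimage_moebius`), so everything can be proved in this coordinate, where all the points
involved are finite: with `w = (a, b, c)` they are `a²`, `b²`, `c²` and `±bc`, `±ca`, `±ab`.

The common point is `u₀ = det A / det B`. It is invariant under cyclic permutations of `a`, `b`, `c`
and under changes of their signs, and these symmetries leave only two circles to consider: the one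
through `bc`, `b²`, `c²`, and the one through `-bc`, `-ca`, `-ab`. For both, the reality of the cross
ratio is a polynomial identity in `a`, `b`, `c` and their conjugates
(`IsCommonPoint.isConcyclic_sq`, `IsCommonPoint.isConcyclic_neg_mul`).

A conic through `±bc`, `±ca`, `±ab` has no linear part unless the six points are collinear, and
its remaining four coefficients satisfy three linear equations, so that they are proportional to
minors. That `u₀` lies on the conic is again a polynomial identity
(`exists_coefficients_of_detD_ne_zero`).

If `det B = 0`, either `|a| = |b| = |c| = 1`, and then the conic and all the circles are the unit
circle, or `a`, `b`, `c` are real multiples of one number, and then all the circles are a line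
through `0`, which every conic through the six points contains (`exists_isCommonPoint`). The common
point can then be taken to be `1` or `0`.
-/

noncomputable section

namespace PolarizedCubic

/-! ### Möbius transformations in homogeneous coordinates -/

lemma quot_of_ne (n : ℂ) {d : ℂ} (hd : d ≠ 0) : quot n d = ((n / d : ℂ) : OnePoint ℂ) := by
  simp [quot, hd]

lemma quot_zero (n : ℂ) : quot n 0 = ∞ := by
  simp [quot]

lemma coe_eq_quot (x : ℂ) : (x : OnePoint ℂ) = quot x 1 := by
  simp [quot]

lemma quot_mul_mul {k : ℂ} (hk : k ≠ 0) (n d : ℂ) : quot (k * n) (k * d) = quot n d := by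
  rcases eq_or_ne d 0 with rfl | hd
  · simp [quot]
  · rw [quot_of_ne _ hd, quot_of_ne _ (mul_ne_zero hk hd), mul_div_mul_left _ _ hk]

lemma exists_eq_quot (x : OnePoint ℂ) : ∃ n d : ℂ, (n ≠ 0 ∨ d ≠ 0) ∧ x = quot n d := by
  induction x using OnePoint.rec with
  | infty => exact ⟨1, 0, by simp, by simp [quot]⟩
  | coe x => exact ⟨x, 1, by simp, coe_eq_quot x⟩

lemma moebius_coe (p q r s x : ℂ) :
    moebius p q r s (x : OnePoint ℂ) = quot (p * x + q) (r * x + s) := rfl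

lemma moebius_infty (p q r s : ℂ) : moebius p q r s ∞ = quot p r := rfl

lemma moebius_quot (p q r s : ℂ) {x y : ℂ} (h : x ≠ 0 ∨ y ≠ 0) :
    moebius p q r s (quot x y) = quot (p * x + q * y) (r * x + s * y) := by
  rcases eq_or_ne y 0 with rfl | hy
  · have hx : x ≠ 0 := by simpa using h
    rw [quot_zero, moebius_infty, ← quot_mul_mul hx]
    congr 1 <;> ring
  · rw [quot_of_ne _ hy, moebius_coe, ← quot_mul_mul hy]
    congr 1 <;> field_simp

lemma linear_ne_zero {p q r s x y : ℂ} (hdet : p * s - q * r ≠ 0) (h : x ≠ 0 ∨ y ≠ 0) :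
    p * x + q * y ≠ 0 ∨ r * x + s * y ≠ 0 := by
  by_contra! H
  have hx : (p * s - q * r) * x = 0 := by linear_combination s * H.1 - q * H.2
  have hy : (p * s - q * r) * y = 0 := by linear_combination p * H.2 - r * H.1
  simp [hdet] at hx hy
  simp [hx, hy] at h

/-- Transformations whose matrices are inverse up to a nonzero scalar `k` are inverse. -/
lemma moebius_leftInverse {p q r s p' q' r' s' k : ℂ} (hdet : p * s - q * r ≠ 0) (hk : k ≠ 0)
    (h₁ : p' * p + q' * r = k) (h₂ : p' * q + q' * s = 0) (h₃ : r' * p + s' * r = 0)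
    (h₄ : r' * q + s' * s = k) (x : OnePoint ℂ) :
    moebius p' q' r' s' (moebius p q r s x) = x := by
  obtain ⟨n, d, h, rfl⟩ := exists_eq_quot x
  rw [moebius_quot _ _ _ _ h, moebius_quot _ _ _ _ (linear_ne_zero hdet h), ← quot_mul_mul hk n d]
  congr 1
  · linear_combination n * h₁ + d * h₂
  · linear_combination n * h₃ + d * h₄

/-! ### Circles of the extended plane -/

/-- The locus of the Hermitian form with coefficients `A`, `B`, `D`, in the normalization used
for `IsCircle`. -/
def hermitianLocus (A D : ℝ) (B : ℂ) : Set (OnePoint ℂ) :=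
  {x | x.elim (A = 0) (fun ζ => A * Complex.normSq ζ + 2 * (conj B * ζ).re + D = 0)}

lemma quot_mem_hermitianLocus (A D : ℝ) (B : ℂ) {n d : ℂ} (h : n ≠ 0 ∨ d ≠ 0) :
    quot n d ∈ hermitianLocus A D B ↔
      A * Complex.normSq n + 2 * (conj B * (n * conj d)).re + D * Complex.normSq d = 0 := by
  rcases eq_or_ne d 0 with rfl | hd
  · have hn : n ≠ 0 := by simpa using h
    rw [quot_zero]
    simp [hermitianLocus, hn]
  · rw [quot_of_ne _ hd]
    have hd' : Complex.normSq d ≠ 0 := by simpa using hd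
    have key : A * Complex.normSq n + 2 * (conj B * (n * conj d)).re + D * Complex.normSq d
        = (A * Complex.normSq (n / d) + 2 * (conj B * (n / d)).re + D) * Complex.normSq d := by
      have h1 : n * conj d = n / d * (Complex.normSq d : ℂ) := by
        rw [← Complex.mul_conj]; field_simp
      rw [h1, Complex.normSq_div, ← mul_assoc (conj B), Complex.re_mul_ofReal]
      field_simp
    rw [key, mul_eq_zero]
    simp [hermitianLocus, hd]

/-- Nonsingular Möbius transformations pull circles back to circles: the Hermitian form is
pulled back by the matrix, and its discriminant is multiplied by `|ps - qr|²`. -/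
lemma IsCircle.preimage_moebius {C : Set (OnePoint ℂ)} (hC : IsCircle C) {p q r s : ℂ}
    (hdet : p * s - q * r ≠ 0) : IsCircle (moebius p q r s ⁻¹' C) := by
  obtain ⟨A, D, B, hlt, rfl⟩ := hC
  refine ⟨A * Complex.normSq p + 2 * (conj B * (p * conj r)).re + D * Complex.normSq r,
    A * Complex.normSq q + 2 * (conj B * (q * conj s)).re + D * Complex.normSq s,
    A * (conj p * q) + B * (conj p * s) + conj B * (q * conj r) + D * (conj r * s), ?_, ?_⟩
  · have hpos : 0 < Complex.normSq (p * s - q * r) * (Complex.normSq B - A * D) :=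
      mul_pos (Complex.normSq_pos.2 hdet) (sub_pos.2 hlt)
    rw [← sub_pos]
    convert hpos using 1
    simp only [Complex.normSq_apply, Complex.add_re, Complex.add_im, Complex.mul_re,
      Complex.mul_im, Complex.sub_re, Complex.sub_im, Complex.conj_re, Complex.conj_im,
      Complex.ofReal_re, Complex.ofReal_im]
    ring
  · ext x
    obtain ⟨n, d, h, rfl⟩ := exists_eq_quot x
    change moebius p q r s (quot n d) ∈ hermitianLocus A D B ↔ quot n d ∈ hermitianLocus _ _ _
    rw [moebius_quot _ _ _ _ h, quot_mem_hermitianLocus _ _ _ (linear_ne_zero hdet h),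
      quot_mem_hermitianLocus _ _ _ h]
    refine Eq.congr ?_ rfl
    simp only [Complex.normSq_apply, Complex.add_re, Complex.add_im, Complex.mul_re,
      Complex.mul_im, Complex.conj_re, Complex.conj_im, map_add, map_mul, Complex.conj_conj,
      Complex.conj_ofReal, Complex.ofReal_re, Complex.ofReal_im]
    ring

/-- The real line together with `∞`. -/
def realCircle : Set (OnePoint ℂ) := {x | x.elim True (fun ζ => ζ.im = 0)}

lemma realCircle_isCircleDeterminedBy : IsCircleDeterminedBy realCircle
    ![∞, ((0 : ℂ) : OnePoint ℂ), ((1 : ℂ) : OnePoint ℂ)] := by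
  refine ⟨⟨⟨0, 0, Complex.I, by simp, ?_⟩, ?_⟩, ?_⟩
  · ext x
    induction x using OnePoint.rec <;> simp [realCircle]
  · intro i
    fin_cases i <;> simp [realCircle]
  · rintro _ ⟨⟨A, D, B, hlt, rfl⟩, h⟩
    have h0 : A = 0 := h 0
    have h1 : D = 0 := by simpa using h 1
    have h2 : B.re = 0 := by simpa [h0, h1] using h 2
    have h3 : B.im ≠ 0 := by
      intro h3
      simp [Complex.normSq_apply, h0, h2, h3] at hlt
    ext x
    induction x using OnePoint.rec <;> simp [realCircle, h0, h1, h2, h3]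

lemma IsCircleDeterminedBy.moebius {C : Set (OnePoint ℂ)} {T : Fin 3 → OnePoint ℂ}
    (hC : IsCircleDeterminedBy C T) {p q r s p' q' r' s' : ℂ} (hdet : p * s - q * r ≠ 0)
    (hdet' : p' * s' - q' * r' ≠ 0)
    (hl : ∀ x, moebius p' q' r' s' (moebius p q r s x) = x)
    (hr : ∀ x, moebius p q r s (moebius p' q' r' s' x) = x) :
    IsCircleDeterminedBy (PolarizedCubic.moebius p' q' r' s' ⁻¹' C)
      (PolarizedCubic.moebius p q r s ∘ T) := by
  refine ⟨⟨hC.1.1.preimage_moebius hdet', fun i => ?_⟩, fun C' hC' => ?_⟩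
  · simpa [hl] using hC.1.2 i
  · rw [← hC.2 (PolarizedCubic.moebius p q r s ⁻¹' C')
      ⟨hC'.1.preimage_moebius hdet, hC'.2⟩]
    ext x
    simp [hr]

/-- The cross ratio of `ζ`, `x₁`, `x₂`, `x₃` is real or infinite, in a form free of denominators:
`ζ` lies on the circle through `x₁`, `x₂`, `x₃`. -/
def IsConcyclic (x₁ x₂ x₃ ζ : ℂ) : Prop :=
  (ζ - x₂) * (x₃ - x₁) * conj ((ζ - x₁) * (x₃ - x₂)) =
    conj ((ζ - x₂) * (x₃ - x₁)) * ((ζ - x₁) * (x₃ - x₂))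

lemma IsConcyclic.rotate {x₁ x₂ x₃ ζ : ℂ} (h : IsConcyclic x₁ x₂ x₃ ζ) :
    IsConcyclic x₂ x₃ x₁ ζ := by
  unfold IsConcyclic at *
  simp only [map_mul, map_sub] at *
  linear_combination h

/-- The images of three distinct finite points under a Möbius transformation determine a circle,
since a suitable transformation sends `x₁`, `x₂`, `x₃` to `∞`, `0`, `1`. -/
lemma exists_isCircleDeterminedBy {p q r s p' q' r' s' : ℂ} (hdet : p * s - q * r ≠ 0)
    (hdet' : p' * s' - q' * r' ≠ 0)
    (hl : ∀ x, moebius p' q' r' s' (moebius p q r s x) = x)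
    (hr : ∀ x, moebius p q r s (moebius p' q' r' s' x) = x)
    {x₁ x₂ x₃ : ℂ} (h12 : x₁ ≠ x₂) (h13 : x₁ ≠ x₃) (h23 : x₂ ≠ x₃) :
    ∃ C, IsCircleDeterminedBy C ![moebius p q r s x₁, moebius p q r s x₂, moebius p q r s x₃] ∧
      ∀ ζ : ℂ, IsConcyclic x₁ x₂ x₃ ζ → moebius p q r s ζ ∈ C := by
  have d12 := sub_ne_zero.2 h12
  have d13 := sub_ne_zero.2 h13
  have d23 := sub_ne_zero.2 h23
  -- the cross ratio `ζ ↦ (ζ - x₂) (x₃ - x₁) / ((ζ - x₁) (x₃ - x₂))` and its inverse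
  have hk : (x₁ - x₂) * (x₁ - x₃) * (x₂ - x₃) ≠ 0 := by positivity
  have hkn : -((x₁ - x₂) * (x₁ - x₃) * (x₂ - x₃)) ≠ 0 := neg_ne_zero.2 hk
  have hg : (x₃ - x₁) * (-x₁ * (x₃ - x₂)) - (-x₂ * (x₃ - x₁)) * (x₃ - x₂) ≠ 0 := by
    convert hkn using 1; ring
  have hg' : (-x₁ * (x₃ - x₂)) * (x₃ - x₁) - (x₂ * (x₃ - x₁)) * (-(x₃ - x₂)) ≠ 0 := by
    convert hkn using 1; ring
  have hgl := moebius_leftInverse (p' := -x₁ * (x₃ - x₂)) (q' := x₂ * (x₃ - x₁))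
    (r' := -(x₃ - x₂)) (s' := x₃ - x₁) hg hkn (by ring) (by ring) (by ring) (by ring)
  have hgr := moebius_leftInverse (p' := x₃ - x₁) (q' := -x₂ * (x₃ - x₁)) (r' := x₃ - x₂)
    (s' := -x₁ * (x₃ - x₂)) hg' hkn (by ring) (by ring) (by ring) (by ring)
  have H := (realCircle_isCircleDeterminedBy.moebius hg' hg hgr hgl).moebius hdet hdet' hl hr
  refine ⟨moebius p' q' r' s' ⁻¹' (moebius (x₃ - x₁) (-x₂ * (x₃ - x₁)) (x₃ - x₂)
    (-x₁ * (x₃ - x₂)) ⁻¹' realCircle), ?_, fun ζ hζ => ?_⟩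
  · convert H using 1
    funext i
    fin_cases i
    · simp only [Function.comp, Fin.zero_eta, Matrix.cons_val_zero, moebius_infty]
      rw [quot_of_ne _ (by rw [neg_ne_zero, sub_ne_zero]; exact h23.symm)]
      congr 2
      have := sub_ne_zero.2 h23.symm
      field_simp
    · simp only [Function.comp, Fin.mk_one, Matrix.cons_val_one, Matrix.cons_val_zero]
      rw [moebius_coe (-x₁ * (x₃ - x₂)), quot_of_ne _ (by simpa [sub_eq_zero] using h13.symm)]
      congr 2
      have := sub_ne_zero.2 h13.symm
      rw [eq_div_iff (by simpa [sub_eq_zero] using h13.symm)]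
      ring
    · simp only [Function.comp, Fin.reduceFinMk, Matrix.cons_val]
      have e : -(x₃ - x₂) * 1 + (x₃ - x₁) = -(x₁ - x₂) := by ring
      rw [moebius_coe (-x₁ * (x₃ - x₂)), e, quot_of_ne _ (neg_ne_zero.2 d12)]
      congr 2
      field_simp
      ring
  · simp only [Set.mem_preimage, hl]
    rw [moebius_coe]
    rcases eq_or_ne ζ x₁ with rfl | h1
    · rw [show (x₃ - x₂) * ζ + -ζ * (x₃ - x₂) = 0 by ring, quot_zero]
      simp [realCircle]
    · have h1' := sub_ne_zero.2 h1
      have h3' := sub_ne_zero.2 h23.symm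
      have e : (x₃ - x₂) * ζ + -x₁ * (x₃ - x₂) = (ζ - x₁) * (x₃ - x₂) := by ring
      rw [e, quot_of_ne _ (mul_ne_zero h1' h3')]
      change Complex.im _ = 0
      have h := mul_ne_zero h1' h3'
      rw [← Complex.conj_eq_iff_im, map_div₀, div_eq_div_iff ((map_ne_zero _).2 h) h]
      unfold IsConcyclic at hζ
      rw [show (x₃ - x₁) * ζ + -x₂ * (x₃ - x₁) = (ζ - x₂) * (x₃ - x₁) by ring]
      exact hζ.symm

/-! ### The common point -/

/-- `a b c · det B` for `w = (a, b, c)`, expanded along the first row of `B`. -/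
def detD (a b c : ℂ) : ℂ :=
  a * conj a ^ 2 * (conj b * c - conj c * b) + b * conj b ^ 2 * (conj c * a - conj a * c)
    + c * conj c ^ 2 * (conj a * b - conj b * a)

/-- `det A` for `w = (a, b, c)`, expanded along the first row of `A`. -/
def detN (a b c : ℂ) : ℂ :=
  conj b * conj c * (conj b * c - conj c * b) + conj a * conj c * (conj c * a - conj a * c)
    + conj a * conj b * (conj a * b - conj b * a)

/-- `a`, `b`, `c` are real multiples of a common complex number. -/
def Parallel (a b c : ℂ) : Prop :=
  conj a * b = conj b * a ∧ conj b * c = conj c * b ∧ conj c * a = conj a * c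

/-- The candidate `x` for the common point in the coordinate `W⁻¹`, where `w = (a, b, c)`.
Outside the generic case, all seven circles coincide with the unit circle or with a line
through `0`. -/
def IsCommonPoint (a b c x : ℂ) : Prop :=
  (detD a b c ≠ 0 ∧ x = a * b * c * detN a b c / detD a b c) ∨
    (conj a * a = 1 ∧ conj b * b = 1 ∧ conj c * c = 1 ∧ x = 1) ∨ (Parallel a b c ∧ x = 0)

lemma Parallel.detD_eq_zero {a b c : ℂ} (h : Parallel a b c) : detD a b c = 0 := by
  obtain ⟨h1, h2, h3⟩ := h
  rw [detD, h1, h2, h3]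
  ring

lemma IsCommonPoint.eq_div {a b c x : ℂ} (h : IsCommonPoint a b c x) (hD : detD a b c ≠ 0) :
    x = a * b * c * detN a b c / detD a b c := by
  rcases h with ⟨-, h⟩ | ⟨ha, hb, hc, -⟩ | ⟨h, -⟩
  · exact h
  · refine absurd ?_ hD
    unfold detD
    linear_combination conj a * (conj b * c - conj c * b) * ha
      + conj b * (conj c * a - conj a * c) * hb + conj c * (conj a * b - conj b * a) * hc
  · exact absurd h.detD_eq_zero hD

lemma IsCommonPoint.rotate {a b c x : ℂ} (h : IsCommonPoint a b c x) : IsCommonPoint b c a x := by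
  have hD : detD b c a = detD a b c := by unfold detD; ring
  have hN : detN b c a = detN a b c := by unfold detN; ring
  unfold IsCommonPoint Parallel at *
  rw [hD, hN, show b * c * a = a * b * c by ring]
  tauto

lemma IsCommonPoint.neg_right {a b c x : ℂ} (h : IsCommonPoint a b c x) :
    IsCommonPoint a b (-c) x := by
  have hD : detD a b (-c) = -detD a b c := by simp only [detD, map_neg]; ring
  have hN : detN a b (-c) = detN a b c := by simp only [detN, map_neg]; ring
  unfold IsCommonPoint Parallel at *
  rw [hD, hN, show a * b * -c * detN a b c = -(a * b * c * detN a b c) by ring, neg_div_neg_eq]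
  simpa using h

/-- The equation `det B = 0` and its conjugate together force the `|w_k|` to be equal, unless the
`w_k` are parallel. -/
lemma exists_isCommonPoint {a b c : ℂ} (habc : (a * b * c) ^ 2 = -1) (hab : a ^ 2 ≠ b ^ 2)
    (hbc : b ^ 2 ≠ c ^ 2) (hca : c ^ 2 ≠ a ^ 2) : ∃ x, IsCommonPoint a b c x := by
  by_cases hD : detD a b c = 0
  swap
  · exact ⟨_, Or.inl ⟨hD, rfl⟩⟩
  by_cases hP : Parallel a b c
  · exact ⟨0, Or.inr (Or.inr ⟨hP, rfl⟩)⟩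
  have hD' := congrArg conj hD
  have hne : a * b * c ≠ 0 := by
    intro h; simp [h] at habc
  have ha : a ≠ 0 := by rintro rfl; simp at hne
  have hb : b ≠ 0 := by rintro rfl; simp at hne
  have hc : c ≠ 0 := by rintro rfl; simp at hne
  simp only [detD, map_add, map_sub, map_mul, map_pow, Complex.conj_conj, map_zero] at hD hD'
  -- a proportional pair of equal modulus has equal squares
  have key : ∀ {s t : ℂ}, s ≠ 0 → t ≠ 0 → s ^ 2 ≠ t ^ 2 → conj s * t = conj t * s →
      conj s * s ≠ conj t * t := by
    intro s t hs ht hst h1 h2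
    apply hst
    have ht' : conj t ≠ 0 := (map_ne_zero _).2 ht
    apply mul_left_cancel₀ ht'
    linear_combination t * h2 - s * h1
  have e1 : (conj a * a - conj c * c) *
      ((conj b * c - conj c * b) * (conj a * b - conj b * a)) = 0 := by
    linear_combination b * hD + conj b * hD'
  have e2 : (conj b * b - conj c * c) *
      ((conj c * a - conj a * c) * (conj a * b - conj b * a)) = 0 := by
    linear_combination -a * hD - conj a * hD'
  have e3 : (conj a * a - conj b * b) *
      ((conj b * c - conj c * b) * (conj c * a - conj a * c)) = 0 := by
    linear_combination -c * hD - conj c * hD'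
  have r1 : a * (conj b * c - conj c * b) + b * (conj c * a - conj a * c)
    + c * (conj a * b - conj b * a) = 0 := by ring
  have hX : conj b * c - conj c * b ≠ 0 := by
    intro h
    rw [h] at r1
    have hk := sub_ne_zero.2 (key hb hc hbc (sub_eq_zero.1 h))
    simp only [hk, mul_eq_zero, false_or] at e2
    apply hP
    rcases e2 with h2 | h2 <;> simp [h2, hb, hc] at r1 <;>
      exact ⟨sub_eq_zero.1 (by assumption), sub_eq_zero.1 h, sub_eq_zero.1 (by assumption)⟩
  have hY : conj c * a - conj a * c ≠ 0 := by
    intro h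
    rw [h] at r1
    have hk := sub_ne_zero.2 (key hc ha hca (sub_eq_zero.1 h))
    have hk' : conj a * a - conj c * c ≠ 0 := by rwa [← neg_sub, neg_ne_zero]
    simp only [hk', mul_eq_zero, false_or] at e1
    apply hP
    rcases e1 with h2 | h2 <;> simp [h2, ha, hc] at r1 <;>
      exact ⟨sub_eq_zero.1 (by assumption), sub_eq_zero.1 (by assumption), sub_eq_zero.1 h⟩
  have hZ : conj a * b - conj b * a ≠ 0 := by
    intro h
    rw [h] at r1
    have hk := sub_ne_zero.2 (key ha hb hab (sub_eq_zero.1 h))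
    simp only [hk, mul_eq_zero, false_or] at e3
    apply hP
    rcases e3 with h2 | h2 <;> simp [h2, ha, hb] at r1 <;>
      exact ⟨sub_eq_zero.1 h, sub_eq_zero.1 (by assumption), sub_eq_zero.1 (by assumption)⟩
  have f1 : conj a * a = conj c * c := by simpa [hX, hZ, sub_eq_zero] using e1
  have f2 : conj b * b = conj c * c := by simpa [hY, hZ, sub_eq_zero] using e2
  have f3 : conj c * c = 1 := by
    have hn : Complex.normSq (a * b * c) = 1 := by
      have := congrArg Complex.normSq habc
      rw [map_pow, Complex.normSq_neg, map_one] at this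
      exact (pow_eq_one_iff_of_nonneg (Complex.normSq_nonneg _) two_ne_zero).1 this
    rw [Complex.conj_mul', ← Complex.ofReal_pow, ← Complex.normSq_eq_norm_sq] at f1 f2 ⊢
    rw [Complex.conj_mul', ← Complex.ofReal_pow, ← Complex.normSq_eq_norm_sq] at f1 f2
    norm_cast at f1 f2 ⊢
    rw [map_mul, map_mul, f1, f2, ← pow_two, ← pow_succ] at hn
    exact (pow_eq_one_iff_of_nonneg (Complex.normSq_nonneg _) three_ne_zero).1 hn
  exact ⟨1, Or.inr (Or.inl ⟨f1.trans f3, f2.trans f3, f3, rfl⟩)⟩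

lemma conj_detD (a b c : ℂ) : conj (detD a b c) =
    conj a * a ^ 2 * (b * conj c - c * conj b) + conj b * b ^ 2 * (c * conj a - a * conj c)
      + conj c * c ^ 2 * (a * conj b - b * conj a) := by
  simp [detD]

lemma conj_detN (a b c : ℂ) : conj (detN a b c) =
    b * c * (b * conj c - c * conj b) + a * c * (c * conj a - a * conj c)
      + a * b * (a * conj b - b * conj a) := by
  simp [detN]

lemma Parallel.exists_conj_eq {a b c : ℂ} (ha : a ≠ 0) (h : Parallel a b c) :
    ∃ t, conj a = t * a ∧ conj b = t * b ∧ conj c = t * c := by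
  obtain ⟨h1, -, h3⟩ := h
  refine ⟨conj a / a, by field_simp, ?_, ?_⟩
  · field_simp; exact h1.symm
  · field_simp; exact h3

/-- The common point lies on the preimage of `C₁`, and, after cyclic permutations of `a`, `b`, `c`,
on those of `C₂` and `C₃`. -/
lemma IsCommonPoint.isConcyclic_sq {a b c x : ℂ} (ha : a ≠ 0) (hb : b ≠ 0) (hc : c ≠ 0)
    (h : IsCommonPoint a b c x) : IsConcyclic (b * c) (b ^ 2) (c ^ 2) x := by
  rcases h with ⟨hD, hx⟩ | ⟨h1, h2, h3, rfl⟩ | ⟨h, rfl⟩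
  · have hD' : conj (detD a b c) ≠ 0 := (map_ne_zero _).2 hD
    rw [eq_div_iff hD] at hx
    have hx' := congrArg conj hx
    simp only [map_mul] at hx'
    have key : (a * b * c * detN a b c - b ^ 2 * detD a b c) * (c ^ 2 - b * c) *
        ((conj a * conj b * conj c * conj (detN a b c) - conj b * conj c * conj (detD a b c))
          * (conj c ^ 2 - conj b ^ 2)) =
        (conj a * conj b * conj c * conj (detN a b c) - conj b ^ 2 * conj (detD a b c))
          * (conj c ^ 2 - conj b * conj c) *
        ((a * b * c * detN a b c - b * c * detD a b c) * (c ^ 2 - b ^ 2)) := by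
      rw [conj_detD, conj_detN, detD, detN]
      ring
    rw [← hx, ← hx'] at key
    apply mul_left_cancel₀ (mul_ne_zero hD hD')
    simp only [map_mul, map_sub, map_pow]
    linear_combination key
  · have e2 : conj b = b⁻¹ := eq_inv_of_mul_eq_one_left h2
    have e3 : conj c = c⁻¹ := eq_inv_of_mul_eq_one_left h3
    simp only [IsConcyclic, map_mul, map_sub, map_pow, map_one, e2, e3]
    field_simp
    ring
  · obtain ⟨t, -, h2, h3⟩ := h.exists_conj_eq ha
    simp only [IsConcyclic, map_mul, map_sub, map_pow, map_zero, h2, h3]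
    ring

/-- The common point lies on the preimage of `C₄`, and, after changes of sign of `a`, `b`, `c`,
on those of `C₅`, `C₆`, `C₇`. -/
lemma IsCommonPoint.isConcyclic_neg_mul {a b c x : ℂ} (ha : a ≠ 0) (hb : b ≠ 0) (hc : c ≠ 0)
    (h : IsCommonPoint a b c x) : IsConcyclic (-(b * c)) (-(c * a)) (-(a * b)) x := by
  rcases h with ⟨hD, hx⟩ | ⟨h1, h2, h3, rfl⟩ | ⟨h, rfl⟩
  · have hD' : conj (detD a b c) ≠ 0 := (map_ne_zero _).2 hD
    rw [eq_div_iff hD] at hx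
    have hx' := congrArg conj hx
    simp only [map_mul] at hx'
    have key : (a * b * c * detN a b c + c * a * detD a b c) * (b * c - a * b) *
        ((conj a * conj b * conj c * conj (detN a b c) + conj b * conj c * conj (detD a b c))
          * (conj c * conj a - conj a * conj b)) =
        (conj a * conj b * conj c * conj (detN a b c) + conj c * conj a * conj (detD a b c))
          * (conj b * conj c - conj a * conj b) *
        ((a * b * c * detN a b c + b * c * detD a b c) * (c * a - a * b)) := by
      rw [conj_detD, conj_detN, detD, detN]
      ring
    rw [← hx, ← hx'] at key
    apply mul_left_cancel₀ (mul_ne_zero hD hD')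
    simp only [map_mul, map_sub, map_neg]
    linear_combination key
  · have e1 : conj a = a⁻¹ := eq_inv_of_mul_eq_one_left h1
    have e2 : conj b = b⁻¹ := eq_inv_of_mul_eq_one_left h2
    have e3 : conj c = c⁻¹ := eq_inv_of_mul_eq_one_left h3
    simp only [IsConcyclic, map_mul, map_sub, map_neg, map_one, e1, e2, e3]
    field_simp
    ring
  · obtain ⟨t, h1, h2, h3⟩ := h.exists_conj_eq ha
    simp only [IsConcyclic, map_mul, map_sub, map_neg, map_zero, h1, h2, h3]
    ring

/-! ### Conics through the six points -/

/-- A real quadratic polynomial on `ℂ`, in terms of `ζ` and its conjugate; the constants `n` and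
`F` need not be real here. -/
def conicForm (m n β F ζ : ℂ) : ℂ :=
  m * ζ ^ 2 + conj m * conj ζ ^ 2 + n * (ζ * conj ζ) + (β * ζ + conj β * conj ζ) + F

lemma conicForm_even {m n β F p : ℂ} (h : conicForm m n β F p = 0 ∧ conicForm m n β F (-p) = 0) :
    m * p ^ 2 + conj m * conj p ^ 2 + n * (p * conj p) + F = 0 ∧
      β * p + conj β * conj p = 0 := by
  simp only [conicForm, map_neg] at h
  constructor
  · linear_combination (h.1 + h.2) / 2
  · linear_combination (h.1 - h.2) / 2

lemma ofReal_conic_eq_conicForm (A B C D E F : ℝ) (ζ : ℂ) :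
    ((A * ζ.re ^ 2 + B * (ζ.re * ζ.im) + C * ζ.im ^ 2 + D * ζ.re + E * ζ.im + F : ℝ) : ℂ) =
      conicForm ⟨(A - C) / 4, -B / 4⟩ ((A + C) / 2 : ℝ) ⟨D / 2, -E / 2⟩ F ζ := by
  apply Complex.ext <;>
    simp [conicForm, pow_two, Complex.ofReal_re, Complex.ofReal_im, Complex.mul_re,
      Complex.mul_im] <;>
    ring

/-- The conic passes through the six points `±bc`, `±ca`, `±ab`. -/
def PassesThrough (m n β F a b c : ℂ) : Prop :=
  (conicForm m n β F (b * c) = 0 ∧ conicForm m n β F (-(b * c)) = 0) ∧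
    (conicForm m n β F (c * a) = 0 ∧ conicForm m n β F (-(c * a)) = 0) ∧
    (conicForm m n β F (a * b) = 0 ∧ conicForm m n β F (-(a * b)) = 0)

/-- If the six points are not collinear, the conic has centre `0`: it has no linear part. -/
lemma PassesThrough.linear_eq_zero {m n β F a b c : ℂ} (ha : a ≠ 0) (hb : b ≠ 0) (hc : c ≠ 0)
    (hP : ¬ Parallel a b c) (h : PassesThrough m n β F a b c) : β = 0 := by
  have h1 := (conicForm_even h.1).2
  have h2 := (conicForm_even h.2.1).2
  have h3 := (conicForm_even h.2.2).2
  simp only [map_mul] at h1 h2 h3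
  by_contra hβ
  have ha' : conj a ≠ 0 := (map_ne_zero _).2 ha
  have hb' : conj b ≠ 0 := (map_ne_zero _).2 hb
  have hc' : conj c ≠ 0 := (map_ne_zero _).2 hc
  refine hP ⟨?_, ?_, ?_⟩
  · apply mul_left_cancel₀ (mul_ne_zero hβ (mul_ne_zero hc hc'))
    linear_combination conj c * conj a * h1 - conj b * conj c * h2
  · apply mul_left_cancel₀ (mul_ne_zero hβ (mul_ne_zero ha ha'))
    linear_combination conj a * conj b * h2 - conj c * conj a * h3
  · apply mul_left_cancel₀ (mul_ne_zero hβ (mul_ne_zero hb hb'))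
    linear_combination conj b * conj c * h3 - conj a * conj b * h1

/-- For `p = bc, ca, ab`, the determinant of the rows `(p², p̄², 1)`. -/
def minorQ (a b c : ℂ) : ℂ :=
  conj a ^ 2 * (b ^ 2 * (c * conj c) ^ 2 - c ^ 2 * (b * conj b) ^ 2)
    + conj b ^ 2 * (c ^ 2 * (a * conj a) ^ 2 - a ^ 2 * (c * conj c) ^ 2)
    + conj c ^ 2 * (a ^ 2 * (b * conj b) ^ 2 - b ^ 2 * (a * conj a) ^ 2)

/-- For `p = bc, ca, ab`, the determinant of the rows `(p², p̄², p p̄)`, divided by `|abc|²`. -/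
def minorV (a b c : ℂ) : ℂ :=
  conj a ^ 2 * (b ^ 2 * (c * conj c) - c ^ 2 * (b * conj b))
    + conj b ^ 2 * (c ^ 2 * (a * conj a) - a ^ 2 * (c * conj c))
    + conj c ^ 2 * (a ^ 2 * (b * conj b) - b ^ 2 * (a * conj a))

/-- The coefficients of a conic through `±p₁`, `±p₂`, `±p₃` are proportional to the minors `v` of
the matrix with rows `(p², p̄², p p̄, 1)`. The last clause says that the common point lies on the
conic with the coefficients `v`. -/
lemma exists_coefficients_of_detD_ne_zero {a b c x : ℂ} (ha : a ≠ 0) (hb : b ≠ 0) (hc : c ≠ 0)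
    (hD : detD a b c ≠ 0) (hx : x = a * b * c * detN a b c / detD a b c) :
    ∃ v₁ v₂ v₃ v₄ : ℂ, (∀ m n β F, PassesThrough m n β F a b c →
      β = 0 ∧ ∃ t, m = t * v₁ ∧ conj m = t * v₂ ∧ n = t * v₃ ∧ F = t * v₄) ∧
      v₁ * x ^ 2 + v₂ * conj x ^ 2 + v₃ * (x * conj x) + v₄ = 0 := by
  have hP : ¬ Parallel a b c := fun h => hD h.detD_eq_zero
  have hD' : conj (detD a b c) ≠ 0 := (map_ne_zero _).2 hD
  have hs : conj a * conj b * conj c ≠ 0 := by simp [ha, hb, hc]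
  have hv : -(conj a * conj b * conj c * detD a b c) ≠ 0 := neg_ne_zero.2 (mul_ne_zero hs hD)
  rw [eq_div_iff hD] at hx
  have hx' := congrArg conj hx
  simp only [map_mul] at hx'
  refine ⟨-(conj a * conj b * conj c * detD a b c), a * b * c * conj (detD a b c),
    minorQ a b c, -(a * b * c * (conj a * conj b * conj c)) * minorV a b c,
    fun m n β F h => ?_, ?_⟩
  · refine ⟨h.linear_eq_zero ha hb hc hP, m / -(conj a * conj b * conj c * detD a b c),
      (div_mul_cancel₀ _ hv).symm, ?_, ?_, ?_⟩
    all_goals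
      have h1 := (conicForm_even h.1).1
      have h2 := (conicForm_even h.2.1).1
      have h3 := (conicForm_even h.2.2).1
      clear hx hx' h
      simp only [map_mul] at h1 h2 h3
      rw [div_mul_eq_mul_div, eq_div_iff hv]
    · rw [conj_detD, detD]
      linear_combination (c * conj c * (a * conj a) - a * conj a * (b * conj b)) * h1 +
        (a * conj a * (b * conj b) - b * conj b * (c * conj c)) * h2 +
        (b * conj b * (c * conj c) - c * conj c * (a * conj a)) * h3
    · rw [detD, minorQ]
      linear_combination ((conj a * conj b) ^ 2 - (conj c * conj a) ^ 2) * h1 +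
        ((conj b * conj c) ^ 2 - (conj a * conj b) ^ 2) * h2 +
        ((conj c * conj a) ^ 2 - (conj b * conj c) ^ 2) * h3
    · rw [detD, minorV]
      linear_combination
        ((conj c * conj a) ^ 2 * (a * conj a * (b * conj b)) -
          (conj a * conj b) ^ 2 * (c * conj c * (a * conj a))) * h1 +
        ((conj a * conj b) ^ 2 * (b * conj b * (c * conj c)) -
          (conj b * conj c) ^ 2 * (a * conj a * (b * conj b))) * h2 +
        ((conj b * conj c) ^ 2 * (c * conj c * (a * conj a)) -
          (conj c * conj a) ^ 2 * (b * conj b * (c * conj c))) * h3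
  · have key : -(a * b * c) * detN a b c ^ 2 * conj (detD a b c)
        + conj a * conj b * conj c * conj (detN a b c) ^ 2 * detD a b c
        + minorQ a b c * detN a b c * conj (detN a b c)
        - minorV a b c * detD a b c * conj (detD a b c) = 0 := by
      rw [conj_detD, conj_detN, detD, detN, minorQ, minorV]
      ring
    apply mul_left_cancel₀ (mul_ne_zero hD hD')
    linear_combination a * b * c * (conj a * conj b * conj c) * key
      - conj a * conj b * conj c * conj (detD a b c) *
        (x * detD a b c + a * b * c * detN a b c) * hx
      + a * b * c * detD a b c *
        (conj x * conj (detD a b c) + conj a * conj b * conj c * conj (detN a b c)) * hx'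
      + minorQ a b c *
        (conj x * conj (detD a b c) * hx + a * b * c * detN a b c * hx')

/-- If `a`, `b`, `c` lie on the unit circle, the unit circle is the only conic through the six
points. -/
lemma coefficients_of_unit {a b c : ℂ} (ha : conj a * a = 1) (hb : conj b * b = 1)
    (hc : conj c * c = 1) (hab : a ^ 2 ≠ b ^ 2) (hbc : b ^ 2 ≠ c ^ 2) (hca : c ^ 2 ≠ a ^ 2)
    {m n β F : ℂ} (h : PassesThrough m n β F a b c) : β = 0 ∧ m = 0 ∧ F = -n := by
  have ha0 : a ≠ 0 := right_ne_zero_of_mul_eq_one ha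
  have hb0 : b ≠ 0 := right_ne_zero_of_mul_eq_one hb
  have hc0 : c ≠ 0 := right_ne_zero_of_mul_eq_one hc
  have hP : ¬ Parallel a b c := by
    rintro ⟨h, -⟩
    apply hab
    linear_combination -a * b * h - a ^ 2 * hb + b ^ 2 * ha
  have hβ := h.linear_eq_zero ha0 hb0 hc0 hP
  have h1 := (conicForm_even h.1).1
  have h2 := (conicForm_even h.2.1).1
  have h3 := (conicForm_even h.2.2).1
  have e1 : conj a = a⁻¹ := eq_inv_of_mul_eq_one_left ha
  have e2 : conj b = b⁻¹ := eq_inv_of_mul_eq_one_left hb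
  have e3 : conj c = c⁻¹ := eq_inv_of_mul_eq_one_left hc
  simp only [map_mul, e1, e2, e3] at h1 h2 h3
  field_simp at h1 h2 h3
  have k1 : m * (a * b * c) ^ 2 * c ^ 2 = conj m := by
    apply mul_left_cancel₀ (sub_ne_zero.2 hab)
    linear_combination b ^ 2 * h2 - a ^ 2 * h1
  have k2 : m * (a * b * c) ^ 2 * a ^ 2 = conj m := by
    apply mul_left_cancel₀ (sub_ne_zero.2 hbc)
    linear_combination c ^ 2 * h3 - b ^ 2 * h2
  have hm : m = 0 := by
    have : m * (a * b * c) ^ 2 * (c ^ 2 - a ^ 2) = 0 := by linear_combination k1 - k2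
    simpa [ha0, hb0, hc0, sub_ne_zero.2 hca] using this
  refine ⟨hβ, hm, ?_⟩
  simp only [hm, map_zero, zero_mul, zero_add, mul_zero] at h1
  apply mul_left_cancel₀ (mul_ne_zero (pow_ne_zero 2 hb0) (pow_ne_zero 2 hc0))
  linear_combination h1

/-- If the six points are on a line through `0`, every conic through them contains this line. -/
lemma PassesThrough.eq_zero_of_parallel {m n β F a b c : ℂ} (ha : a ≠ 0)
    (hab : a ^ 2 ≠ b ^ 2) (hP : Parallel a b c) (h : PassesThrough m n β F a b c) :
    F = 0 := by
  have h1 := (conicForm_even h.1).1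
  have h2 := (conicForm_even h.2.1).1
  obtain ⟨t, e1, e2, e3⟩ := hP.exists_conj_eq ha
  simp only [map_mul, e1, e2, e3] at h1 h2
  have : F * (a ^ 2 - b ^ 2) = 0 := by linear_combination a ^ 2 * h1 - b ^ 2 * h2
  simpa [sub_ne_zero.2 hab] using this

/-- The common point lies on every conic through the six points. -/
lemma IsCommonPoint.conicForm_eq_zero {m n β F a b c x : ℂ} (ha : a ≠ 0) (hb : b ≠ 0)
    (hc : c ≠ 0) (hab : a ^ 2 ≠ b ^ 2) (hbc : b ^ 2 ≠ c ^ 2) (hca : c ^ 2 ≠ a ^ 2)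
    (hx : IsCommonPoint a b c x) (h : PassesThrough m n β F a b c) :
    conicForm m n β F x = 0 := by
  rcases hx with ⟨hD, hx⟩ | ⟨h1, h2, h3, rfl⟩ | ⟨hP, rfl⟩
  · obtain ⟨v₁, v₂, v₃, v₄, hv, hvx⟩ := exists_coefficients_of_detD_ne_zero ha hb hc hD hx
    obtain ⟨rfl, t, e1, e2, e3, e4⟩ := hv _ _ _ _ h
    rw [conicForm, e2, e1, e3, e4]
    simp only [map_zero]
    linear_combination t * hvx
  · obtain ⟨rfl, rfl, rfl⟩ := coefficients_of_unit h1 h2 h3 hab hbc hca h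
    simp [conicForm]
  · simp [conicForm, h.eq_zero_of_parallel ha hab hP]

/-- Unless the six points are collinear, two conics through them have proportional
coefficients. -/
lemma IsCommonPoint.exists_coefficients {a b c x : ℂ} (ha : a ≠ 0) (hb : b ≠ 0)
    (hc : c ≠ 0) (hab : a ^ 2 ≠ b ^ 2) (hbc : b ^ 2 ≠ c ^ 2) (hca : c ^ 2 ≠ a ^ 2)
    (hP : ¬ Parallel a b c) (hx : IsCommonPoint a b c x) :
    ∃ v₁ v₂ v₃ v₄ : ℂ, ∀ m n β F, PassesThrough m n β F a b c →
      β = 0 ∧ ∃ t, m = t * v₁ ∧ conj m = t * v₂ ∧ n = t * v₃ ∧ F = t * v₄ := by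
  rcases hx with ⟨hD, hx⟩ | ⟨h1, h2, h3, -⟩ | ⟨h, -⟩
  · obtain ⟨v₁, v₂, v₃, v₄, hv, -⟩ := exists_coefficients_of_detD_ne_zero ha hb hc hD hx
    exact ⟨v₁, v₂, v₃, v₄, hv⟩
  · refine ⟨0, 0, 1, -1, fun m n β F h => ?_⟩
    obtain ⟨rfl, rfl, rfl⟩ := coefficients_of_unit h1 h2 h3 hab hbc hca h
    exact ⟨rfl, n, by simp⟩
  · exact absurd h hP

/-- The zero set of a real quadratic polynomial. -/
def conicSet (A B C D E F : ℝ) : Set ℂ :=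
  {ζ | A * ζ.re ^ 2 + B * (ζ.re * ζ.im) + C * ζ.im ^ 2 + D * ζ.re + E * ζ.im + F = 0}

lemma mem_conicSet {A B C D E F : ℝ} {ζ : ℂ} : ζ ∈ conicSet A B C D E F ↔
    conicForm ⟨(A - C) / 4, -B / 4⟩ ((A + C) / 2 : ℝ) ⟨D / 2, -E / 2⟩ F ζ = 0 := by
  rw [← ofReal_conic_eq_conicForm, Complex.ofReal_eq_zero]
  rfl

/-- `N` contains the six points. -/
def ContainsSix (N : Set ℂ) (a b c : ℂ) : Prop :=
  (b * c ∈ N ∧ -(b * c) ∈ N) ∧ (c * a ∈ N ∧ -(c * a) ∈ N) ∧ (a * b ∈ N ∧ -(a * b) ∈ N)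

lemma exists_isConic_containsSix (a b c : ℂ) :
    ∃ N, IsConic N ∧ ContainsSix N a b c := by
  -- three equations for the four coefficients of an even conic
  let M : Matrix (Fin 4) (Fin 4) ℝ :=
    !![(b * c).re ^ 2, (b * c).re * (b * c).im, (b * c).im ^ 2, 1;
      (c * a).re ^ 2, (c * a).re * (c * a).im, (c * a).im ^ 2, 1;
      (a * b).re ^ 2, (a * b).re * (a * b).im, (a * b).im ^ 2, 1;
      0, 0, 0, 0]
  obtain ⟨v, hv, hMv⟩ := Matrix.exists_mulVec_eq_zero_iff.2
    (Matrix.det_eq_zero_of_row_eq_zero (A := M) 3 (fun j => by fin_cases j <;> rfl))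
  have e : ∀ i, M.mulVec v i = 0 := fun i => congrFun hMv i
  have e0 := e 0
  have e1 := e 1
  have e2 := e 2
  simp only [M, Matrix.mulVec, dotProduct, Fin.sum_univ_four, Matrix.of_apply, Matrix.cons_val,
    one_mul] at e0 e1 e2
  refine ⟨conicSet (v 0) (v 1) (v 2) 0 0 (v 3), ⟨_, _, _, _, _, _, ?_, rfl⟩, ?_⟩
  · rintro ⟨h0, h1, h2⟩
    apply hv
    rw [h0, h1, h2] at e0
    funext i
    fin_cases i
    · exact h0
    · exact h1
    · exact h2
    · simpa using e0
  · refine ⟨⟨?_, ?_⟩, ⟨?_, ?_⟩, ⟨?_, ?_⟩⟩ <;>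
      simp only [conicSet, Set.mem_ofPred_eq, Complex.neg_re, Complex.neg_im]
    · linear_combination e0
    · linear_combination e0
    · linear_combination e1
    · linear_combination e1
    · linear_combination e2
    · linear_combination e2

lemma ContainsSix.passesThrough {A B C D E F : ℝ} {a b c : ℂ}
    (h : ContainsSix (conicSet A B C D E F) a b c) :
    PassesThrough ⟨(A - C) / 4, -B / 4⟩ ((A + C) / 2 : ℝ) ⟨D / 2, -E / 2⟩ F a b c := by
  simpa only [PassesThrough, ContainsSix, mem_conicSet] using h

lemma IsConic.mem_of_isCommonPoint {N : Set ℂ} {a b c x : ℂ} (hN : IsConic N) (ha : a ≠ 0)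
    (hb : b ≠ 0) (hc : c ≠ 0) (hab : a ^ 2 ≠ b ^ 2) (hbc : b ^ 2 ≠ c ^ 2) (hca : c ^ 2 ≠ a ^ 2)
    (hx : IsCommonPoint a b c x) (h : ContainsSix N a b c) : x ∈ N := by
  obtain ⟨A, B, C, D, E, F, -, rfl⟩ := hN
  exact mem_conicSet.2 (hx.conicForm_eq_zero ha hb hc hab hbc hca h.passesThrough)

lemma IsConic.eq_of_containsSix {N N' : Set ℂ} {a b c x : ℂ} (hN : IsConic N) (hN' : IsConic N')
    (ha : a ≠ 0) (hb : b ≠ 0) (hc : c ≠ 0) (hab : a ^ 2 ≠ b ^ 2) (hbc : b ^ 2 ≠ c ^ 2)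
    (hca : c ^ 2 ≠ a ^ 2) (hP : ¬ Parallel a b c) (hx : IsCommonPoint a b c x)
    (h : ContainsSix N a b c) (h' : ContainsSix N' a b c) : N = N' := by
  obtain ⟨v₁, v₂, v₃, v₄, hv⟩ := hx.exists_coefficients ha hb hc hab hbc hca hP
  have key : ∀ N, IsConic N → ContainsSix N a b c →
      N = {ζ | v₁ * ζ ^ 2 + v₂ * conj ζ ^ 2 + v₃ * (ζ * conj ζ) + v₄ = 0} := by
    rintro N ⟨A, B, C, D, E, F, hne, rfl⟩ h
    obtain ⟨hβ, t, h1, h2, h3, h4⟩ := hv _ _ _ _ (ContainsSix.passesThrough h)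
    have ht : t ≠ 0 := by
      rintro rfl
      rw [zero_mul] at h1 h3
      have r1 := congrArg Complex.re h1
      have r2 := congrArg Complex.im h1
      have r3 := congrArg Complex.re h3
      simp only [Complex.zero_re, Complex.zero_im, Complex.ofReal_re] at r1 r2 r3
      exact hne ⟨by linarith, by linarith, by linarith⟩
    ext ζ
    refine mem_conicSet.trans ?_
    have e : conicForm ⟨(A - C) / 4, -B / 4⟩ ((A + C) / 2 : ℝ) ⟨D / 2, -E / 2⟩ F ζ =
        t * (v₁ * ζ ^ 2 + v₂ * conj ζ ^ 2 + v₃ * (ζ * conj ζ) + v₄) := by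
      rw [conicForm, h2, h1, h3, h4, hβ, map_zero]
      ring
    rw [e, mul_eq_zero, or_iff_right ht, Set.mem_ofPred_eq]
  rw [key N hN h, key N' hN' h']

/-! ### The transformation `W` and the polarization -/

lemma e₁_add_e₂ : e₁ + e₂ = 1 := by
  have h : e₁ + e₂ = 2 * Complex.cos ((Real.pi / 3 : ℝ) : ℂ) := by
    rw [Complex.cos, e₁, e₂]
    push_cast
    ring_nf
  rw [h, ← Complex.ofReal_cos, Real.cos_pi_div_three]
  norm_num

lemma e₁_mul_e₂ : e₁ * e₂ = 1 := by
  rw [e₁, e₂, ← Complex.exp_add, neg_add_cancel, Complex.exp_zero]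

lemma e₁_ne_e₂ : e₁ ≠ e₂ := by
  intro h
  have h1 := e₁_add_e₂
  have h2 := e₁_mul_e₂
  rw [h] at h1 h2
  have : (4 : ℂ) = 1 := by linear_combination -4 * h2 + (2 * e₂ + 1) * h1
  norm_num at this

variable (α z : Fin 3 → ℂ)

lemma three_mul_coeffN : 3 * coeffN α =
    -((α 0 + α 1 + α 2) * coeffR α + coeffS α ^ 2) := by
  have h2 : e₂ = 1 - e₁ := by linear_combination e₁_add_e₂
  have h1 : e₁ ^ 2 = e₁ - 1 := by linear_combination e₁ * e₁_add_e₂ - e₁_mul_e₂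
  simp only [coeffN, coeffR, coeffS, h2, e₃]
  linear_combination (α 1 - α 0) ^ 2 * h1

lemma three_mul_coeffM : 3 * coeffM α =
    -((α 0 + α 1 + α 2) * coeffS α + coeffR α ^ 2) := by
  have h2 : e₂ = 1 - e₁ := by linear_combination e₁_add_e₂
  have h1 : e₁ ^ 2 = e₁ - 1 := by linear_combination e₁ * e₁_add_e₂ - e₁_mul_e₂
  simp only [coeffM, coeffR, coeffS, h2, e₃]
  linear_combination (α 0 - α 1) ^ 2 * h1

lemma three_mul_coeffB : 3 * coeffB α =
    (α 0 + α 1 + α 2) ^ 2 - coeffR α * coeffS α := by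
  have h2 : e₂ = 1 - e₁ := by linear_combination e₁_add_e₂
  have h1 : e₁ ^ 2 = e₁ - 1 := by linear_combination e₁ * e₁_add_e₂ - e₁_mul_e₂
  simp only [coeffB, coeffR, coeffS, h2, e₃]
  linear_combination -(α 0 - α 1) ^ 2 * h1

lemma mul_coeffC : 27 * coeffC α = -((α 0 + α 1 + α 2) ^ 3
    - 3 * (α 0 + α 1 + α 2) * (coeffR α * coeffS α) - coeffR α ^ 3 - coeffS α ^ 3) := by
  have h2 : e₂ = 1 - e₁ := by linear_combination e₁_add_e₂
  have h1 : e₁ ^ 2 = e₁ - 1 := by linear_combination e₁ * e₁_add_e₂ - e₁_mul_e₂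
  simp only [coeffC, coeffR, coeffS, h2, e₃]
  linear_combination 9 * (α 0 - α 1) ^ 2 * α 2 * h1

variable {α z}

lemma coeffS_pow_sub_ne_zero (hα : Function.Injective α) :
    coeffS α ^ 3 - coeffR α ^ 3 ≠ 0 := by
  have h01 : α 0 - α 1 ≠ 0 := sub_ne_zero.2 (hα.ne (by decide))
  have h12 : α 1 - α 2 ≠ 0 := sub_ne_zero.2 (hα.ne (by decide))
  have h02 : α 0 - α 2 ≠ 0 := sub_ne_zero.2 (hα.ne (by decide))
  have k1 : 1 + e₁ ≠ 0 := by
    intro h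
    have : (3 : ℂ) = 0 := by
      linear_combination (2 - e₁) * h + e₁ * e₁_add_e₂ - e₁_mul_e₂
    norm_num at this
  have k2 : 1 + e₂ ≠ 0 := by
    intro h
    have : (3 : ℂ) = 0 := by
      linear_combination (2 - e₂) * h + e₂ * e₁_add_e₂ - e₁_mul_e₂
    norm_num at this
  have k3 : e₂ - e₁ ≠ 0 := sub_ne_zero.2 e₁_ne_e₂.symm
  have f1 : coeffS α - coeffR α = (e₂ - e₁) * (α 0 - α 1) := by
    simp only [coeffS, coeffR]; ring
  have f2 : coeffS α + e₁ * coeffR α = (1 + e₁) * (α 1 - α 2) := by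
    simp only [coeffS, coeffR, e₃]
    linear_combination α 0 * (e₁ + 1) * e₁_add_e₂ + (α 1 - α 0) * e₁_mul_e₂
  have f3 : coeffS α + e₂ * coeffR α = (1 + e₂) * (α 0 - α 2) := by
    simp only [coeffS, coeffR, e₃]
    linear_combination α 1 * (e₂ + 1) * e₁_add_e₂ + (α 0 - α 1) * e₁_mul_e₂
  have f : coeffS α ^ 3 - coeffR α ^ 3 = (coeffS α - coeffR α) *
      ((coeffS α + e₁ * coeffR α) * (coeffS α + e₂ * coeffR α)) := by
    linear_combination -(coeffS α - coeffR α) * (coeffS α * coeffR α * e₁_add_e₂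
      + coeffR α ^ 2 * e₁_mul_e₂)
  rw [f, f1, f2, f3]
  exact mul_ne_zero (mul_ne_zero k3 h01) (mul_ne_zero (mul_ne_zero k1 h12) (mul_ne_zero k2 h02))

lemma det_W_ne_zero (hα : Function.Injective α) :
    -coeffN α * coeffS α - -coeffM α * coeffR α ≠ 0 := by
  intro h
  apply coeffS_pow_sub_ne_zero hα
  linear_combination 3 * h + coeffS α * three_mul_coeffN α - coeffR α * three_mul_coeffM α

lemma det_Winv_ne_zero (hα : Function.Injective α) :
    -coeffS α * coeffN α - -coeffM α * coeffR α ≠ 0 := by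
  convert det_W_ne_zero hα using 1
  ring

lemma Winv_W (hα : Function.Injective α) (x : OnePoint ℂ) : Winv α (W α x) = x :=
  moebius_leftInverse (det_W_ne_zero hα) (neg_ne_zero.2 (det_W_ne_zero hα))
    (by ring) (by ring) (by ring) (by ring) x

lemma W_Winv (hα : Function.Injective α) (x : OnePoint ℂ) : W α (Winv α x) = x :=
  moebius_leftInverse (det_Winv_ne_zero hα) (neg_ne_zero.2 (det_Winv_ne_zero hα))
    (by ring) (by ring) (by ring) (by ring) x

/-- The polarization in homogeneous coordinates `(xᵢ, yᵢ)`. -/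
def homP (α : Fin 3 → ℂ) (x₁ y₁ x₂ y₂ x₃ y₃ : ℂ) : ℂ :=
  x₁ * x₂ * x₃ + coeffA α / 3 * (x₁ * x₂ * y₃ + x₂ * x₃ * y₁ + x₃ * x₁ * y₂)
    + coeffB α / 3 * (x₁ * y₂ * y₃ + x₂ * y₁ * y₃ + x₃ * y₁ * y₂) + coeffC α * (y₁ * y₂ * y₃)

/-- In the coordinate `W⁻¹`, the polarization becomes that of a multiple of `u³ + 1`. -/
lemma homP_W (α : Fin 3 → ℂ) (x₁ y₁ x₂ y₂ x₃ y₃ : ℂ) :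
    homP α (-coeffN α * x₁ + -coeffM α * y₁) (coeffR α * x₁ + coeffS α * y₁)
      (-coeffN α * x₂ + -coeffM α * y₂) (coeffR α * x₂ + coeffS α * y₂)
      (-coeffN α * x₃ + -coeffM α * y₃) (coeffR α * x₃ + coeffS α * y₃) =
    (coeffS α ^ 3 - coeffR α ^ 3) ^ 2 / 27 * (x₁ * x₂ * x₃ + y₁ * y₂ * y₃) := by
  have hN : coeffN α = -((α 0 + α 1 + α 2) * coeffR α + coeffS α ^ 2) / 3 := by
    linear_combination three_mul_coeffN α / 3
  have hM : coeffM α = -((α 0 + α 1 + α 2) * coeffS α + coeffR α ^ 2) / 3 := by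
    linear_combination three_mul_coeffM α / 3
  have hB : coeffB α = ((α 0 + α 1 + α 2) ^ 2 - coeffR α * coeffS α) / 3 := by
    linear_combination three_mul_coeffB α / 3
  have hC : coeffC α = -((α 0 + α 1 + α 2) ^ 3 - 3 * (α 0 + α 1 + α 2) * (coeffR α * coeffS α)
      - coeffR α ^ 3 - coeffS α ^ 3) / 27 := by
    linear_combination mul_coeffC α / 27
  rw [homP, hN, hM, hB, hC, coeffA]
  generalize coeffR α = R
  generalize coeffS α = S
  generalize α 0 + α 1 + α 2 = T
  ring

lemma quot_mem_biZeros (t : ℂ) {n d : ℂ} (h : n ≠ 0 ∨ d ≠ 0) :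
    quot n d ∈ biZeros α t ↔ homP α n d n d t 1 = 0 := by
  rcases eq_or_ne d 0 with rfl | hd
  · have hn : n ≠ 0 := by simpa using h
    have e : homP α n 0 n 0 t 1 = n ^ 2 * (t + coeffA α / 3) := by
      rw [homP]; ring
    rw [quot_zero, e]
    simp [biZeros, hn]
  · have e : homP α n d n d t 1 = d ^ 2 * P α (n / d) (n / d) t := by
      rw [homP, P]; field_simp
    rw [quot_of_ne _ hd, e]
    simp [biZeros, hd]

lemma w_sq (k : Fin 3) : w α z k ^ 2 = u α z k := by
  rw [w, Complex.sqrt]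
  exact Complex.cpow_nat_inv_pow _ two_ne_zero

lemma coe_u (hα : Function.Injective α) (hz : IsNondegenerateSolution α z) (k : Fin 3) :
    ((u α z k : ℂ) : OnePoint ℂ) = Winv α (z k) := by
  have h : Winv α (z k) ≠ ∞ := fun h => (hz.2 k).1 <| by
    rw [← W_Winv hα (z k), h]; rfl
  obtain ⟨x, hx⟩ := OnePoint.ne_infty_iff_exists.1 h
  rw [u, ← hx]
  rfl

lemma W_u (hα : Function.Injective α) (hz : IsNondegenerateSolution α z) (k : Fin 3) :
    W α (u α z k : ℂ) = z k := by
  rw [coe_u hα hz, W_Winv hα]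

lemma u_ne_zero (hα : Function.Injective α) (hz : IsNondegenerateSolution α z) (k : Fin 3) :
    u α z k ≠ 0 := fun h => (hz.2 k).2 <| by
  rw [← W_u hα hz, h, W, moebius_coe, vStar]
  simp

/-- The relation `z = W(u)` between finite points, free of denominators. -/
lemma mul_denom (hα : Function.Injective α) (hz : IsNondegenerateSolution α z) (k : Fin 3) :
    coeffR α * u α z k + coeffS α ≠ 0 ∧
      -coeffN α * u α z k + -coeffM α = z k * (coeffR α * u α z k + coeffS α) := by
  have h := W_u hα hz k
  rw [W, moebius_coe] at h
  have hd : coeffR α * u α z k + coeffS α ≠ 0 := by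
    intro hd
    rw [hd, quot_zero] at h
    exact OnePoint.infty_ne_coe _ h
  rw [quot_of_ne _ hd, OnePoint.coe_eq_coe, div_eq_iff hd] at h
  exact ⟨hd, h⟩

lemma u_mul_u_mul_u (hα : Function.Injective α) (hz : IsNondegenerateSolution α z) :
    u α z 0 * u α z 1 * u α z 2 = -1 := by
  have h := homP_W α (u α z 0) 1 (u α z 1) 1 (u α z 2) 1
  simp only [mul_one, (mul_denom hα hz _).2] at h
  have e : ∀ y₀ y₁ y₂ : ℂ, homP α (z 0 * y₀) y₀ (z 1 * y₁) y₁ (z 2 * y₂) y₂ =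
      P α (z 0) (z 1) (z 2) * (y₀ * y₁ * y₂) := fun y₀ y₁ y₂ => by
    rw [homP, P]; ring
  rw [e, hz.1, zero_mul, eq_comm, mul_eq_zero, or_iff_right] at h
  · linear_combination h
  · exact div_ne_zero (pow_ne_zero 2 (coeffS_pow_sub_ne_zero hα)) (by norm_num)

lemma W_quot_mem_biZeros (hα : Function.Injective α) (hz : IsNondegenerateSolution α z)
    (k : Fin 3) {x y : ℂ} (h : x ≠ 0 ∨ y ≠ 0) :
    W α (quot x y) ∈ biZeros α (z k) ↔ x ^ 2 * u α z k + y ^ 2 = 0 := by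
  obtain ⟨hd, he⟩ := mul_denom hα hz k
  have hK : (coeffS α ^ 3 - coeffR α ^ 3) ^ 2 / 27 ≠ 0 :=
    div_ne_zero (pow_ne_zero 2 (coeffS_pow_sub_ne_zero hα)) (by norm_num)
  have key := homP_W α x y x y (u α z k) 1
  simp only [mul_one, he] at key
  rw [W, moebius_quot _ _ _ _ h, quot_mem_biZeros _ (linear_ne_zero (det_W_ne_zero hα) h),
    ← mul_eq_zero_iff_left hd]
  have e : ∀ n d t s : ℂ, homP α n d n d (t * s) s = homP α n d n d t 1 * s :=
    fun n d t s => by rw [homP, homP]; ring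
  rw [e] at key
  rw [mul_comm, key, mul_eq_zero, or_iff_right hK, ← pow_two, ← pow_two]

lemma f_zero_eq (k : Fin 3) : f α z k 0 = W α ((w α z (k + 1) * w α z (k + 2) : ℂ)) := rfl

lemma f_one_eq (k : Fin 3) : f α z k 1 = W α ((-(w α z (k + 1) * w α z (k + 2)) : ℂ)) := rfl

/-- `f_{k,1}` and `f_{k,2}` are the zeros of `ζ ↦ P(ζ, ζ, z_k)`. -/
lemma biZeros_eq (hα : Function.Injective α) (hz : IsNondegenerateSolution α z) (k : Fin 3) :
    f α z k 0 ≠ f α z k 1 ∧ biZeros α (z k) = {f α z k 0, f α z k 1} := by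
  have hW : Function.Injective (W α) := Function.LeftInverse.injective (Winv_W hα)
  have huk := u_ne_zero hα hz k
  have hu : u α z k * (u α z (k + 1) * u α z (k + 2)) = -1 := by
    rw [← u_mul_u_mul_u hα hz]
    fin_cases k <;> simp <;> ring
  have hw : (w α z (k + 1) * w α z (k + 2)) ^ 2 = u α z (k + 1) * u α z (k + 2) := by
    rw [mul_pow, w_sq, w_sq]
  rw [f_zero_eq, f_one_eq]
  rw [← hw] at hu
  generalize w α z (k + 1) * w α z (k + 2) = s at hu
  have hs : s ≠ 0 := by
    rintro rfl
    simp at hu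
  constructor
  · rw [hW.ne_iff, Ne, OnePoint.coe_eq_coe]
    exact fun h => hs (self_eq_neg.1 h)
  · ext x
    rw [← W_Winv hα x]
    obtain ⟨n, d, h, e⟩ := exists_eq_quot (Winv α x)
    rw [e, W_quot_mem_biZeros hα hz k h, Set.mem_insert_iff, Set.mem_singleton_iff,
      hW.eq_iff, hW.eq_iff]
    rcases eq_or_ne d 0 with rfl | hd
    · have hn : n ≠ 0 := by simpa using h
      simp [quot_zero, hn, huk]
    · rw [quot_of_ne _ hd, OnePoint.coe_eq_coe, OnePoint.coe_eq_coe, ← sq_eq_sq_iff_eq_or_eq_neg,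
        div_pow, div_eq_iff (pow_ne_zero 2 hd)]
      constructor
      · intro H
        apply mul_left_cancel₀ huk
        linear_combination H - d ^ 2 * hu
      · intro H
        linear_combination u α z k * H + d ^ 2 * hu

/-! ### The configuration attached to a solution -/

lemma Winv_f (hα : Function.Injective α) (k : Fin 3) (i : Fin 2) :
    Winv α (f α z k i) = uu α z k i := Winv_W hα _

lemma w_ne_zero (hα : Function.Injective α) (hz : IsNondegenerateSolution α z) (k : Fin 3) :
    w α z k ≠ 0 := fun h => u_ne_zero hα hz k (by rw [← w_sq, h]; simp)

lemma w_sq_ne (hα : Function.Injective α) (hz : IsNondegenerateSolution α z)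
    (hdist : Function.Injective z) {k l : Fin 3} (h : k ≠ l) : w α z k ^ 2 ≠ w α z l ^ 2 := by
  intro H
  rw [w_sq, w_sq] at H
  apply h
  apply hdist
  rw [← OnePoint.coe_eq_coe, ← W_u hα hz, ← W_u hα hz, H]

lemma W_w_sq (hα : Function.Injective α) (hz : IsNondegenerateSolution α z) (k : Fin 3) :
    W α (w α z k ^ 2 : ℂ) = z k := by
  rw [w_sq, W_u hα hz]

lemma isConicThrough_iff (hα : Function.Injective α) (N : Set ℂ) :
    IsConicThrough N α z ↔ IsConic N ∧ ContainsSix N (w α z 0) (w α z 1) (w α z 2) := by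
  have e : ∀ k i, (∃ ζ ∈ N, (ζ : OnePoint ℂ) = Winv α (f α z k i)) ↔ uu α z k i ∈ N := by
    intro k i
    rw [Winv_f hα]
    constructor
    · rintro ⟨ζ, hζ, h⟩
      rwa [← OnePoint.coe_eq_coe.1 h]
    · exact fun h => ⟨_, h, rfl⟩
  unfold IsConicThrough
  simp only [e]
  exact and_congr_right fun _ => ⟨fun h => ⟨⟨h 0 0, h 0 1⟩, ⟨h 1 0, h 1 1⟩, ⟨h 2 0, h 2 1⟩⟩,
    fun h k i => by
      fin_cases k <;> fin_cases i
      exacts [h.1.1, h.1.2, h.2.1.1, h.2.1.2, h.2.2.1, h.2.2.2]⟩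

lemma Parallel.collinear (hα : Function.Injective α) (hz : IsNondegenerateSolution α z)
    (h : Parallel (w α z 0) (w α z 1) (w α z 2)) : Collinear ℝ (conicPoints α z) := by
  have h0 := w_ne_zero hα hz 0
  have h1 := w_ne_zero hα hz 1
  have h2 := w_ne_zero hα hz 2
  obtain ⟨p1, p2, p3⟩ := h
  -- the quotients of the six points by `b c` are real
  have real : ∀ {s : ℂ}, conj s = s → ∃ r : ℝ, s = r := fun hs =>
    (Complex.conj_eq_iff_real.1 hs).imp fun _ h => h
  obtain ⟨r, hr⟩ := real (s := w α z 0 / w α z 1) (by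
    rw [map_div₀, div_eq_div_iff ((map_ne_zero _).2 h1) h1]
    linear_combination p1)
  obtain ⟨s, hs⟩ := real (s := w α z 0 / w α z 2) (by
    rw [map_div₀, div_eq_div_iff ((map_ne_zero _).2 h2) h2]
    linear_combination -p3)
  rw [div_eq_iff h1] at hr
  rw [div_eq_iff h2] at hs
  refine (collinear_iff_exists_forall_eq_smul_vadd _).2 ⟨0, w α z 1 * w α z 2, ?_⟩
  rintro ζ ⟨k, i, hζ⟩
  rw [Winv_f hα, OnePoint.coe_eq_coe] at hζ
  subst hζ
  simp only [vadd_eq_add, add_zero, Complex.real_smul]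
  fin_cases k <;> fin_cases i
  · exact ⟨1, by simp [uu]⟩
  · exact ⟨-1, by simp [uu]⟩
  · refine ⟨r, ?_⟩
    change w α z 2 * w α z 0 = _
    linear_combination w α z 2 * hr
  · refine ⟨-r, ?_⟩
    change -(w α z 2 * w α z 0) = _
    push_cast
    linear_combination -w α z 2 * hr
  · refine ⟨s, ?_⟩
    change w α z 0 * w α z 1 = _
    linear_combination w α z 1 * hs
  · refine ⟨-s, ?_⟩
    change -(w α z 0 * w α z 1) = _
    push_cast
    linear_combination -w α z 1 * hs

lemma det_matA : (matA α z).det = detN (w α z 0) (w α z 1) (w α z 2) := by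
  rw [matA, Matrix.det_fin_three, detN]
  simp
  ring

lemma mul_det_matB (hα : Function.Injective α) (hz : IsNondegenerateSolution α z) :
    w α z 0 * w α z 1 * w α z 2 * (matB α z).det = detD (w α z 0) (w α z 1) (w α z 2) := by
  have h0 := w_ne_zero hα hz 0
  have h1 := w_ne_zero hα hz 1
  have h2 := w_ne_zero hα hz 2
  rw [matB, Matrix.det_fin_three, detD]
  simp only [← w_sq, map_pow, Matrix.of_apply, Matrix.cons_val]
  field_simp
  ring

/-- The seven circles, each with the common point on it. -/
lemma exists_circle (hα : Function.Injective α) (hz : IsNondegenerateSolution α z)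
    (hdist : Function.Injective z) {x : ℂ}
    (hx : IsCommonPoint (w α z 0) (w α z 1) (w α z 2) x) (j : Fin 7) :
    ∃ C, IsCircleDeterminedBy C (circlePoints α z j) ∧ W α x ∈ C := by
  have h0 := w_ne_zero hα hz 0
  have h1 := w_ne_zero hα hz 1
  have h2 := w_ne_zero hα hz 2
  have h01 : w α z 0 ^ 2 ≠ w α z 1 ^ 2 := w_sq_ne hα hz hdist (by decide)
  have h12 : w α z 1 ^ 2 ≠ w α z 2 ^ 2 := w_sq_ne hα hz hdist (by decide)
  have h20 : w α z 2 ^ 2 ≠ w α z 0 ^ 2 := w_sq_ne hα hz hdist (by decide)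
  have key : ∀ {x₁ x₂ x₃ : ℂ}, x₁ ≠ x₂ → x₁ ≠ x₃ → x₂ ≠ x₃ → IsConcyclic x₁ x₂ x₃ x →
      ∃ C, IsCircleDeterminedBy C ![W α x₁, W α x₂, W α x₃] ∧ W α x ∈ C := by
    intro x₁ x₂ x₃ a b c hc
    obtain ⟨C, hC, h⟩ := exists_isCircleDeterminedBy (det_W_ne_zero hα) (det_Winv_ne_zero hα)
      (Winv_W hα) (W_Winv hα) a b c
    exact ⟨C, hC, h x hc⟩
  have z0 := W_w_sq hα hz 0
  have z1 := W_w_sq hα hz 1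
  have z2 := W_w_sq hα hz 2
  -- distinctness of the three points of a triple
  have n1 : ∀ {a b : ℂ}, b ≠ 0 → a ^ 2 ≠ b ^ 2 → a * b ≠ b ^ 2 := fun hb h e =>
    h (by rw [mul_right_cancel₀ hb (e.trans (pow_two _))])
  have n2 : ∀ {a b : ℂ}, a ≠ 0 → a ^ 2 ≠ b ^ 2 → a * b ≠ a ^ 2 := fun ha h e =>
    h (by rw [mul_left_cancel₀ ha (e.trans (pow_two _))])
  have n3 : ∀ {p q a b : ℂ} (c : ℂ), c ≠ 0 → a ^ 2 ≠ b ^ 2 → p ^ 2 = (b * c) ^ 2 →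
      q ^ 2 = (c * a) ^ 2 → p ≠ q := fun c hc h hp hq e => by
    apply h
    apply mul_left_cancel₀ (pow_ne_zero 2 hc)
    rw [e, hq] at hp
    linear_combination hp
  have m : ∀ {a b c : ℂ}, a ≠ 0 → b ≠ 0 → c ≠ 0 → a ^ 2 ≠ b ^ 2 → b ^ 2 ≠ c ^ 2 →
      c ^ 2 ≠ a ^ 2 → IsCommonPoint a b c x → ∃ C, IsCircleDeterminedBy C
        ![W α (-(b * c) : ℂ), W α (-(c * a) : ℂ), W α (-(a * b) : ℂ)] ∧ W α x ∈ C := by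
    intro a b c ha hb hc hab hbc hca h
    exact key (n3 c hc hab (by ring) (by ring)) (n3 b hb hca.symm (by ring) (by ring))
      (n3 a ha hbc (by ring) (by ring)) (h.isConcyclic_neg_mul ha hb hc)
  generalize hw0 : w α z 0 = a at *
  generalize hw1 : w α z 1 = b at *
  generalize hw2 : w α z 2 = c at *
  have f00 : f α z 0 0 = W α (b * c : ℂ) := by rw [← hw1, ← hw2]; rfl
  have f10 : f α z 1 0 = W α (c * a : ℂ) := by rw [← hw2, ← hw0]; rfl
  have f20 : f α z 2 0 = W α (a * b : ℂ) := by rw [← hw0, ← hw1]; rfl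
  have f01 : f α z 0 1 = W α (-(b * c) : ℂ) := by rw [← hw1, ← hw2]; rfl
  have f11 : f α z 1 1 = W α (-(c * a) : ℂ) := by rw [← hw2, ← hw0]; rfl
  have f21 : f α z 2 1 = W α (-(a * b) : ℂ) := by rw [← hw0, ← hw1]; rfl
  have hxa := hx.rotate
  have hxb := hxa.rotate
  fin_cases j
  · change ∃ C, IsCircleDeterminedBy C ![f α z 0 0, z 1, z 2] ∧ _
    rw [f00, ← z1, ← z2]
    exact key (n2 h1 h12) (n1 h2 h12) h12 (hx.isConcyclic_sq h0 h1 h2)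
  · change ∃ C, IsCircleDeterminedBy C ![z 0, f α z 1 0, z 2] ∧ _
    rw [f10, ← z0, ← z2]
    exact key (n1 h0 h20).symm h20.symm (n2 h2 h20)
      (hxa.isConcyclic_sq h1 h2 h0).rotate.rotate
  · change ∃ C, IsCircleDeterminedBy C ![z 0, z 1, f α z 2 0] ∧ _
    rw [f20, ← z0, ← z1]
    exact key h01 (n2 h0 h01).symm (n1 h1 h01).symm (hxb.isConcyclic_sq h2 h0 h1).rotate
  · change ∃ C, IsCircleDeterminedBy C ![f α z 0 1, f α z 1 1, f α z 2 1] ∧ _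
    rw [f01, f11, f21]
    exact m h0 h1 h2 h01 h12 h20 hx
  · change ∃ C, IsCircleDeterminedBy C ![f α z 0 0, f α z 1 0, f α z 2 1] ∧ _
    rw [f00, f10, f21]
    simpa using m h0 h1 (neg_ne_zero.2 h2) h01 (by simpa using h12) (by simpa using h20)
      hx.neg_right
  · change ∃ C, IsCircleDeterminedBy C ![f α z 0 0, f α z 1 1, f α z 2 0] ∧ _
    rw [f00, f11, f20]
    simpa using m h0 (neg_ne_zero.2 h1) h2 (by simpa using h01) (by simpa using h12) h20
      hxb.neg_right.rotate
  · change ∃ C, IsCircleDeterminedBy C ![f α z 0 1, f α z 1 0, f α z 2 0] ∧ _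
    rw [f01, f10, f20]
    simpa using m (neg_ne_zero.2 h0) h1 h2 (by simpa using h01) h12 (by simpa using h20)
      hxa.neg_right.rotate.rotate

end PolarizedCubic

end

theorem theorem5 (α : Fin 3 → ℂ) (hα : Function.Injective α)
    (z : Fin 3 → ℂ) (hz : PolarizedCubic.IsNondegenerateSolution α z)
    (hdist : Function.Injective z) :
    -- the points `f_{k,1}`, `f_{k,2}` are the two zeros of `ζ ↦ P(ζ, ζ, z_k)`
    (∀ k, PolarizedCubic.f α z k 0 ≠ PolarizedCubic.f α z k 1 ∧
      PolarizedCubic.biZeros α (z k) = {PolarizedCubic.f α z k 0, PolarizedCubic.f α z k 1}) ∧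
    ∃ C : Fin 7 → Set (OnePoint ℂ),
      -- each of the seven circles is well determined by its three points
      (∀ j, PolarizedCubic.IsCircleDeterminedBy (C j) (PolarizedCubic.circlePoints α z j)) ∧
      -- a conic through the six points exists, and is unique unless the points are collinear
      (∃ N, PolarizedCubic.IsConicThrough N α z) ∧
      (¬ Collinear ℝ (PolarizedCubic.conicPoints α z) →
        ∀ N N', PolarizedCubic.IsConicThrough N α z → PolarizedCubic.IsConicThrough N' α z →
          N = N') ∧
      -- the common point of the seven circles and the image of the conic
      ∃ x : OnePoint ℂ, (∀ j, x ∈ C j) ∧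
        (∀ N, PolarizedCubic.IsConicThrough N α z →
          ∃ ζ ∈ N, PolarizedCubic.W α ((ζ : ℂ) : OnePoint ℂ) = x) ∧
        ((PolarizedCubic.matB α z).det ≠ 0 →
          x = PolarizedCubic.W α ((PolarizedCubic.u₀ α z : ℂ) : OnePoint ℂ)) := by

  have hab : PolarizedCubic.w α z 0 ^ 2 ≠ PolarizedCubic.w α z 1 ^ 2 :=
    PolarizedCubic.w_sq_ne hα hz hdist (by decide)
  have hbc : PolarizedCubic.w α z 1 ^ 2 ≠ PolarizedCubic.w α z 2 ^ 2 :=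
    PolarizedCubic.w_sq_ne hα hz hdist (by decide)
  have hca : PolarizedCubic.w α z 2 ^ 2 ≠ PolarizedCubic.w α z 0 ^ 2 :=
    PolarizedCubic.w_sq_ne hα hz hdist (by decide)
  have ha := PolarizedCubic.w_ne_zero hα hz 0
  have hb := PolarizedCubic.w_ne_zero hα hz 1
  have hc := PolarizedCubic.w_ne_zero hα hz 2
  have habc : (PolarizedCubic.w α z 0 * PolarizedCubic.w α z 1 * PolarizedCubic.w α z 2) ^ 2
      = -1 := by
    rw [mul_pow, mul_pow, PolarizedCubic.w_sq, PolarizedCubic.w_sq, PolarizedCubic.w_sq,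
      PolarizedCubic.u_mul_u_mul_u hα hz]
  obtain ⟨x, hx⟩ := PolarizedCubic.exists_isCommonPoint habc hab hbc hca
  choose C hC hxC using PolarizedCubic.exists_circle hα hz hdist hx
  refine ⟨PolarizedCubic.biZeros_eq hα hz, C, hC, ?_, ?_, PolarizedCubic.W α x, hxC, ?_, ?_⟩
  · obtain ⟨N, hN⟩ := PolarizedCubic.exists_isConic_containsSix (PolarizedCubic.w α z 0)
      (PolarizedCubic.w α z 1) (PolarizedCubic.w α z 2)
    exact ⟨N, (PolarizedCubic.isConicThrough_iff hα N).2 hN⟩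
  · intro hcol N N' hN hN'
    rw [PolarizedCubic.isConicThrough_iff hα] at hN hN'
    exact hN.1.eq_of_containsSix hN'.1 ha hb hc hab hbc hca
      (fun h => hcol (h.collinear hα hz)) hx hN.2 hN'.2
  · intro N hN
    rw [PolarizedCubic.isConicThrough_iff hα] at hN
    exact ⟨x, hN.1.mem_of_isCommonPoint ha hb hc hab hbc hca hx hN.2, rfl⟩
  · intro hB
    have hs := mul_ne_zero (mul_ne_zero ha hb) hc
    have hD := PolarizedCubic.mul_det_matB hα hz
    rw [hx.eq_div (by rw [← hD]; exact mul_ne_zero hs hB), ← hD, ← PolarizedCubic.det_matA,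
      mul_div_mul_left _ _ hs]
    rfl
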